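/- For a profinite group $G$ write $x^y=y^{-1}xy$. The complete nonabelian tensor square $G\,\widehat\otimes\,G$ is the profinite group topologically generated by symbols $x\,\widehat\otimes\,y$ $(x,y\in G)$, depending continuously on $(x,y)\in G\times G$, subject to the relations $xy\,\widehat\otimes\,z=(x^y\,\widehat\otimes\,z^y)(y\,\widehat\otimes\,z)$ and $y\,\widehat\otimes\,tz=(y\,\widehat\otimes\,z)(y^z\,\widehat\otimes\,t^z)$ for all $x,y,z,t\in G$. Let $\widehat\nabla(G)$ be the closed (central) subgroup topologically generated by all $x\,\widehat\otimes\,x$. The complete nonabelian exterior square is $G\,\widehat\wedge\,G=(G\,\widehat\otimes\,G)/\widehat\nabla(G)$, and $x\,\widehat\wedge\,y$ denotes the image of $x\,\widehat\otimes\,y$. The exterior degree of $G$ is $$\widehat{\mathrm d}(G)=(\mu\times\mu)\bigl(\{(x,y)\in G\times G : x\,\widehat\wedge\,y=1\}\bigr),$$ where $\mu$ is the normalized Haar measure of $G$ and $\mu\times\mu$ denotes the normalized Haar measure of the compact group $G\times G$. Theorem. Let $p\neq q$ be primes, let $G$ be a pro-$p$-group and let $H$ be a pro-$q$-group. Then $$\widehat{\mathrm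 d}(G\times H)=\widehat{\mathrm d}(G)\,\widehat{\mathrm d}(H).$$ -/

import Mathlib

open MeasureTheory Topology

namespace CompleteExterior

/-! ### Projective limits of quotients of a group -/

section InverseLimit

variable {T : Type*} [Group T] {ι : Type*} (N : ι → Subgroup T) [∀ i, (N i).Normal]

/-- The projective limit of the quotients `T ⧸ N i` along the canonical maps
`T ⧸ N i → T ⧸ N j` (`N i ≤ N j`), as the group of compatible families. If `T` is a topological
space it carries the topology induced by the product of the quotient topologies. -/
def invLim : Subgroup (∀ i, T ⧸ N i) where
  carrier := {x | ∀ i j (h : N i ≤ N j),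
    QuotientGroup.map (N i) (N j) (MonoidHom.id T) h (x i) = x j}
  mul_mem' := fun {x y} hx hy i j h => by
    rw [Pi.mul_apply, Pi.mul_apply, map_mul, hx i j h, hy i j h]
  one_mem' := fun i j h => by
    rw [Pi.one_apply, Pi.one_apply, map_one]
  inv_mem' := fun {x} hx i j h => by
    rw [Pi.inv_apply, Pi.inv_apply, map_inv, hx i j h]

/-- The canonical homomorphism from `T` to the projective limit of the `T ⧸ N i`. -/
def toInvLim : T →* invLim N where
  toFun t := ⟨fun i => (t : T ⧸ N i), fun _ _ _ => rfl⟩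
  map_one' := rfl
  map_mul' _ _ := rfl

end InverseLimit

/-! ### Pro-`p`-groups -/

section ProP

variable (p : ℕ) (G : Type*) [Group G] [TopologicalSpace G]

/-- The closed normal subgroups `N` of `G` such that `G ⧸ N` is a finite group of `p`-power
order. -/
def PFilter : Type _ :=
  {N : Subgroup G // N.Normal ∧ IsClosed (N : Set G) ∧ ∃ k : ℕ, Nat.card (G ⧸ N) = p ^ k}

instance (N : PFilter p G) : N.1.Normal := N.2.1

/-- A compact Hausdorff group `G` is a pro-`p`-group if the canonical map from `G` to the
projective limit of its finite quotients `G ⧸ N` of `p`-power order, `N` closed and normal, is an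
isomorphism of topological groups. -/
def IsProP [IsTopologicalGroup G] [CompactSpace G] [T2Space G] : Prop :=
  IsHomeomorph (toInvLim (fun N : PFilter p G => N.1))

end ProP

/-! ### The nonabelian tensor square as an abstract group -/

section TensorSquare

variable (G : Type*) [Group G]

/-- The defining relators of the nonabelian tensor square, with `x ^ y = y⁻¹ * x * y`:
`xy ⊗ z = (x ^ y ⊗ z ^ y) (y ⊗ z)` and `y ⊗ tz = (y ⊗ z) (y ^ z ⊗ t ^ z)`. -/
def tensorRels : Set (FreeGroup (G × G)) :=
  {r | ∃ x y z : G, r = FreeGroup.of (x * y, z) *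
      (FreeGroup.of (y⁻¹ * x * y, y⁻¹ * z * y) * FreeGroup.of (y, z))⁻¹} ∪
  {r | ∃ y t z : G, r = FreeGroup.of (y, t * z) *
      (FreeGroup.of (y, z) * FreeGroup.of (z⁻¹ * y * z, z⁻¹ * t * z))⁻¹}

/-- The abstract group with generators the symbols `x ⊗ y` and the relations `tensorRels G`. -/
def TensorSquare : Type _ := PresentedGroup (tensorRels G)

instance : Group (TensorSquare G) := inferInstanceAs (Group (PresentedGroup (tensorRels G)))

/-- The abstract tensor square is regarded as a discrete space; this only serves to make its
finite quotients discrete. -/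
instance : TopologicalSpace (TensorSquare G) := ⊥

instance : DiscreteTopology (TensorSquare G) := ⟨rfl⟩

variable {G}

/-- The symbol `x ⊗ y`. -/
def tmk (x y : G) : TensorSquare G := PresentedGroup.of (rels := tensorRels G) (x, y)

theorem tmk_mul_left (x y z : G) :
    tmk (x * y) z = tmk (y⁻¹ * x * y) (y⁻¹ * z * y) * tmk y z := by
  have h := PresentedGroup.one_of_mem (rels := tensorRels G) (Or.inl ⟨x, y, z, rfl⟩)
  rw [map_mul, map_inv, map_mul] at h
  exact mul_inv_eq_one.mp h

theorem tmk_mul_right (y t z : G) :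
    tmk y (t * z) = tmk y z * tmk (z⁻¹ * y * z) (z⁻¹ * t * z) := by
  have h := PresentedGroup.one_of_mem (rels := tensorRels G) (Or.inr ⟨y, t, z, rfl⟩)
  rw [map_mul, map_inv, map_mul] at h
  exact mul_inv_eq_one.mp h

/-- The elements `x ⊗ x` commute with the generators of the tensor square. -/
theorem tmk_self_comm_tmk (b u v : G) : tmk b b * tmk u v = tmk u v * tmk b b := by
  obtain ⟨a, rfl⟩ : ∃ a, u = b⁻¹ * (b⁻¹ * a * b) * b := ⟨b * (b * u * b⁻¹) * b⁻¹, by group⟩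
  obtain ⟨c, rfl⟩ : ∃ c, v = b⁻¹ * (b⁻¹ * c * b) * b := ⟨b * (b * v * b⁻¹) * b⁻¹, by group⟩
  have h1 : tmk (a * b) (c * b) = tmk (b⁻¹ * a * b) b *
      tmk (b⁻¹ * (b⁻¹ * a * b) * b) (b⁻¹ * (b⁻¹ * c * b) * b) * (tmk b b *
        tmk b (b⁻¹ * c * b)) := by
    rw [tmk_mul_left, tmk_mul_right b c b,
      show b⁻¹ * (c * b) * b = (b⁻¹ * c * b) * b by group, tmk_mul_right,
      show b⁻¹ * b * b = b by group]
  have h2 : tmk (a * b) (c * b) = tmk (b⁻¹ * a * b) b * tmk b b *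
      (tmk (b⁻¹ * (b⁻¹ * a * b) * b) (b⁻¹ * (b⁻¹ * c * b) * b) *
        tmk b (b⁻¹ * c * b)) := by
    rw [tmk_mul_right (a * b) c b, tmk_mul_left a b b,
      show b⁻¹ * (a * b) * b = (b⁻¹ * a * b) * b by group,
      tmk_mul_left (b⁻¹ * a * b) b (b⁻¹ * c * b), show b⁻¹ * b * b = b by group]
  have h := h2.symm.trans h1
  simp only [mul_assoc] at h ⊢
  have h' := mul_left_cancel h
  simp only [← mul_assoc] at h' ⊢
  exact mul_right_cancel h'

theorem tmk_self_mem_center (b : G) : tmk b b ∈ Subgroup.center (TensorSquare G) := by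
  have htop : ∀ g : TensorSquare G, g ∈ Subgroup.centralizer {tmk b b} := by
    have hcl : Subgroup.closure (Set.range fun z : G × G => tmk z.1 z.2) = ⊤ :=
      PresentedGroup.closure_range_of (tensorRels G)
    have hle : Subgroup.closure (Set.range fun z : G × G => tmk z.1 z.2) ≤
        Subgroup.centralizer {tmk b b} := by
      rw [Subgroup.closure_le]
      rintro _ ⟨⟨u, v⟩, rfl⟩
      exact Subgroup.mem_centralizer_singleton_iff.mpr (tmk_self_comm_tmk b u v).symm
    intro g
    exact hle (hcl ▸ Subgroup.mem_top g)
  exact Subgroup.mem_center_iff.mpr fun g =>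
    Subgroup.mem_centralizer_singleton_iff.mp (htop g)

end TensorSquare

/-! ### The complete nonabelian tensor square and exterior square -/

section Complete

variable (G : Type*) [Group G] [TopologicalSpace G]

/-- The normal subgroups `N` of finite index in the abstract tensor square for which the map
`(x, y) ↦ (x ⊗ y) N` from `G × G` to the finite discrete group `(G ⊗ G) ⧸ N` is continuous. -/
def TensorFilter : Type _ :=
  {N : Subgroup (TensorSquare G) // N.Normal ∧ N.FiniteIndex ∧
    Continuous fun z : G × G => (tmk z.1 z.2 : TensorSquare G ⧸ N)}

instance (N : TensorFilter G) : N.1.Normal := N.2.1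

/-- The complete nonabelian tensor square of a profinite group `G`: the profinite group
topologically generated by symbols `x ⊗ y`, depending continuously on `(x, y)`, subject to the
relations `tensorRels G`. It is the projective limit of all finite discrete groups with these
generators and relations in which the symbols depend continuously on `(x, y)`. -/
def CompleteTensorSquare : Type _ := invLim (fun N : TensorFilter G => N.1)

instance : Group (CompleteTensorSquare G) :=
  inferInstanceAs (Group (invLim (fun N : TensorFilter G => N.1)))

instance : TopologicalSpace (CompleteTensorSquare G) :=
  inferInstanceAs (TopologicalSpace (invLim (fun N : TensorFilter G => N.1)))

instance : IsTopologicalGroup (CompleteTensorSquare G) :=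
  inferInstanceAs (IsTopologicalGroup (invLim (fun N : TensorFilter G => N.1)))

variable {G}

/-- The topological generator `x ⊗ y` of the complete tensor square. -/
def ctmk (x y : G) : CompleteTensorSquare G := toInvLim (fun N : TensorFilter G => N.1) (tmk x y)

variable (G)

/-- The closed subgroup of the complete tensor square topologically generated by the elements
`x ⊗ x`. -/
def nabla : Subgroup (CompleteTensorSquare G) :=
  (Subgroup.closure (Set.range fun x : G => ctmk x x)).topologicalClosure

instance nabla_normal : (nabla G).Normal := by
  have hc : Subgroup.closure (Set.range fun x : G => ctmk x x) ≤
      Subgroup.center (CompleteTensorSquare G) := by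
    rw [Subgroup.closure_le]
    rintro _ ⟨x, rfl⟩
    refine Subgroup.mem_center_iff.mpr fun g => Subtype.ext (funext fun N => ?_)
    change g.1 N * (tmk x x : TensorSquare G ⧸ N.1) = (tmk x x : TensorSquare G ⧸ N.1) * g.1 N
    obtain ⟨t, ht⟩ := QuotientGroup.mk_surjective (g.1 N)
    rw [← ht, ← QuotientGroup.mk_mul, ← QuotientGroup.mk_mul,
      Subgroup.mem_center_iff.mp (tmk_self_mem_center x) t]
  have hn : (Subgroup.closure (Set.range fun x : G => ctmk x x)).Normal := by
    constructor
    intro n hn g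
    rw [Subgroup.mem_center_iff.mp (hc hn) g, mul_inv_cancel_right]
    exact hn
  exact Subgroup.is_normal_topologicalClosure _

/-- The complete nonabelian exterior square of `G`. -/
abbrev CompleteExteriorSquare : Type _ := CompleteTensorSquare G ⧸ nabla G

variable {G}

/-- The element `x ∧ y` of the complete exterior square. -/
def wedge (x y : G) : CompleteExteriorSquare G := (ctmk x y : CompleteTensorSquare G ⧸ nabla G)

/-! ### The exterior degree -/

variable (G)

/-- The set of pairs `(x, y)` with `x ∧ y = 1` in the complete exterior square. -/
def exteriorPairs : Set (G × G) := {z | wedge z.1 z.2 = 1}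

/-- The exterior degree of a profinite group `G`: the measure of the closed set of pairs
`(x, y)` with `x ∧ y = 1`, for the product `μ × μ` of the normalized Haar measure `μ` of `G` with
itself. This product is the normalized Haar measure of the compact group `G × G`; it is taken in
that form in order to have it on all Borel sets of `G × G`, also when `G` is not second
countable. -/
noncomputable def exteriorDegree [IsTopologicalGroup G] [CompactSpace G] : ℝ :=
  letI : MeasurableSpace (G × G) := borel (G × G)
  haveI : BorelSpace (G × G) := ⟨rfl⟩
  ((Measure.haarMeasure (⊤ : TopologicalSpace.PositiveCompacts (G × G))) (exteriorPairs G)).toReal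

end Complete

end CompleteExterior

namespace CompleteExterior

/-! ### Haar measures of compact groups and products -/

section Haar

open Measure

variable {X Y Z : Type*}
  [Group X] [TopologicalSpace X] [IsTopologicalGroup X] [CompactSpace X]
  [MeasurableSpace X] [BorelSpace X]
  [Group Y] [TopologicalSpace Y] [IsTopologicalGroup Y] [CompactSpace Y]
  [MeasurableSpace Y] [BorelSpace Y]
  [Group Z] [TopologicalSpace Z] [IsTopologicalGroup Z] [CompactSpace Z]
  [MeasurableSpace Z] [BorelSpace Z]

/-! The heart is that `a ∧ b = 1` in the exterior square of `G × H` exactly when it holds for both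
pairs of components. One direction is functoriality of the complete exterior square along the
projections. For the other, functoriality along the inclusions kills the two pure terms, and the
mixed symbols `(g, 1) ⊗ (1, h)` are trivial: the two entries commute, so the symbol is
multiplicative in powers of each entry, and continuity forces its order in every finite quotient to
divide both a power of `p` and a power of `q`. The defining relations then assemble `a ∧ b` from
trivial factors.

The pairs for `G × H` are thus cut out by one condition on the `G` coordinates and one on the `H`
coordinates. These are independent events for Haar measure, by uniqueness of invariant measures
(`haarMeasure_top_preimage_inter`). -/

theorem haarMeasure_top_univ :
    haarMeasure (⊤ : TopologicalSpace.PositiveCompacts X) Set.univ = 1 :=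
  haarMeasure_self

/-- On a compact group, a finite left invariant Borel measure is the multiple of the normalized
Haar measure by its total mass. -/
theorem apply_eq_univ_mul_haarMeasure_top (ν : Measure X) [IsFiniteMeasure ν]
    [IsMulLeftInvariant ν] {s : Set X} (hs : MeasurableSet s) :
    ν s = ν Set.univ * haarMeasure (⊤ : TopologicalSpace.PositiveCompacts X) s := by
  -- Every set has compact closure here, so uniqueness of Haar measure applies without regularity of
  -- `ν`.
  have key : ∀ {t : Set X}, MeasurableSet t →
      ν t = haarScalarFactor ν (haarMeasure ⊤) • haarMeasure ⊤ t := fun {t} ht =>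
    measure_isMulInvariant_eq_smul_of_isCompact_closure_of_measurableSet ν (haarMeasure ⊤) ht
      isClosed_closure.isCompact
  rw [key hs, key MeasurableSet.univ, haarMeasure_top_univ, ENNReal.smul_def, ENNReal.smul_def,
    smul_eq_mul, smul_eq_mul, mul_one]

/-- A continuous surjective homomorphism of compact groups preserves the normalized Haar
measures. -/
theorem haarMeasure_top_preimage (g : Z →* Y) (hg : Continuous g)
    (hsurj : Function.Surjective g) {B : Set Y} (hB : MeasurableSet B) :
    haarMeasure (⊤ : TopologicalSpace.PositiveCompacts Z) (g ⁻¹' B) =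
      haarMeasure (⊤ : TopologicalSpace.PositiveCompacts Y) B := by
  have : IsFiniteMeasure (haarMeasure (⊤ : TopologicalSpace.PositiveCompacts Z)) :=
    ⟨by rw [haarMeasure_top_univ]; exact ENNReal.one_lt_top⟩
  have : IsMulLeftInvariant ((haarMeasure (⊤ : TopologicalSpace.PositiveCompacts Z)).map g) :=
    isMulLeftInvariant_map g.toMulHom hg.measurable hsurj
  have h := apply_eq_univ_mul_haarMeasure_top
    ((haarMeasure (⊤ : TopologicalSpace.PositiveCompacts Z)).map g) hB
  rwa [map_apply hg.measurable hB, map_apply hg.measurable MeasurableSet.univ, Set.preimage_univ,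
    haarMeasure_top_univ, one_mul] at h

/-- If two continuous homomorphisms `f`, `g` of compact groups are jointly surjective, then the
events defined by `f` and by `g` are independent for the normalized Haar measure. -/
theorem haarMeasure_top_preimage_inter (f : Z →* X) (hf : Continuous f) (g : Z →* Y)
    (hg : Continuous g) (hsurj : Function.Surjective fun z => (f z, g z))
    {A : Set X} (hA : MeasurableSet A) {B : Set Y} (hB : MeasurableSet B) :
    haarMeasure (⊤ : TopologicalSpace.PositiveCompacts Z) (f ⁻¹' A ∩ g ⁻¹' B) =
      haarMeasure (⊤ : TopologicalSpace.PositiveCompacts X) A *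
        haarMeasure (⊤ : TopologicalSpace.PositiveCompacts Y) B := by
  set μ := haarMeasure (⊤ : TopologicalSpace.PositiveCompacts Z) with hμ
  have : IsFiniteMeasure μ := ⟨by rw [haarMeasure_top_univ]; exact ENNReal.one_lt_top⟩
  have happ : ∀ {s : Set X}, MeasurableSet s →
      (μ.restrict (g ⁻¹' B)).map f s = μ (f ⁻¹' s ∩ g ⁻¹' B) := fun {s} hs => by
    rw [map_apply hf.measurable hs, restrict_apply (hf.measurable hs)]
  have : IsMulLeftInvariant ((μ.restrict (g ⁻¹' B)).map f) := by
    refine ⟨fun x => Measure.ext fun s hs => ?_⟩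
    -- Translation by such a `z` acts as `x` through `f` and preserves `g ⁻¹' B`.
    obtain ⟨z, hz⟩ := hsurj (x, 1)
    have hz1 : f z = x := congrArg Prod.fst hz
    have hz2 : g z = 1 := congrArg Prod.snd hz
    rw [map_apply (measurable_const_mul x) hs, happ (measurable_const_mul x hs), happ hs,
      ← measure_preimage_mul μ z (f ⁻¹' s ∩ g ⁻¹' B)]
    congr 1
    ext w
    simp [hz1, hz2]
  have hgs : Function.Surjective g := fun y => (hsurj (1, y)).imp fun _ h => congrArg Prod.snd h
  have h := apply_eq_univ_mul_haarMeasure_top ((μ.restrict (g ⁻¹' B)).map f) hA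
  rw [happ hA, happ MeasurableSet.univ, Set.preimage_univ, Set.univ_inter, hμ,
    haarMeasure_top_preimage g hg hgs hB] at h
  rw [hμ, h, mul_comm]

end Haar

/-! ### Power maps on pro-`p`-groups -/

/-- The topology is induced from the quotients `G ⧸ N`; in one of order `p ^ k` the sequence is `1`
from index `k` on. -/
theorem IsProP.tendsto_pow {p : ℕ} {G : Type*} [Group G] [TopologicalSpace G]
    [IsTopologicalGroup G] [CompactSpace G] [T2Space G] (hG : IsProP p G) (g : G) :
    Filter.Tendsto (fun k : ℕ => g ^ p ^ k) Filter.atTop (𝓝 1) := by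
  rw [hG.isInducing.tendsto_nhds_iff, Topology.IsInducing.subtypeVal.tendsto_nhds_iff,
    tendsto_pi_nhds]
  intro N
  refine tendsto_const_nhds.congr' ?_
  obtain ⟨k, hk⟩ := N.2.2.2
  filter_upwards [Filter.eventually_ge_atTop k] with m hm
  change ((1 : G) : G ⧸ N.1) = ((g ^ p ^ m : G) : G ⧸ N.1)
  obtain ⟨d, rfl⟩ := Nat.exists_eq_add_of_le hm
  rw [QuotientGroup.mk_pow, pow_add, pow_mul, ← hk, pow_card_eq_one', one_pow,
    QuotientGroup.mk_one]

/-! ### The symbols in the complete squares -/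

section Symbols

variable {G : Type*} [Group G]

theorem tmk_one_left (y : G) : tmk 1 y = 1 := by
  have h := tmk_mul_left 1 1 y
  simpa using h

theorem tmk_one_right (x : G) : tmk x 1 = 1 := by
  have h := tmk_mul_right x 1 1
  simpa using h

/-- Conjugation by `x` fixes both `x ^ n` and `y`, so the defining relation loses its twist. -/
theorem tmk_pow_left {x y : G} (h : Commute x y) (n : ℕ) : tmk (x ^ n) y = tmk x y ^ n := by
  induction n with
  | zero => rw [pow_zero, pow_zero, tmk_one_left]
  | succ n ih =>
    rw [pow_succ, tmk_mul_left, pow_succ, ← ih, mul_assoc, mul_assoc, h.symm.eq,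
      ((Commute.refl x).pow_left n).eq, inv_mul_cancel_left, inv_mul_cancel_left]

theorem tmk_pow_right {x y : G} (h : Commute x y) (n : ℕ) : tmk x (y ^ n) = tmk x y ^ n := by
  induction n with
  | zero => rw [pow_zero, pow_zero, tmk_one_right]
  | succ n ih =>
    rw [pow_succ, tmk_mul_right, pow_succ', ← ih, mul_assoc, mul_assoc, h.eq,
      ((Commute.refl y).pow_left n).eq, inv_mul_cancel_left, inv_mul_cancel_left]

variable [TopologicalSpace G]

theorem ctmk_mul_left (x y z : G) :
    ctmk (x * y) z = ctmk (y⁻¹ * x * y) (y⁻¹ * z * y) * ctmk y z :=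
  (congrArg (toInvLim fun N : TensorFilter G => N.1) (tmk_mul_left x y z)).trans (map_mul _ _ _)

theorem ctmk_mul_right (y t z : G) :
    ctmk y (t * z) = ctmk y z * ctmk (z⁻¹ * y * z) (z⁻¹ * t * z) :=
  (congrArg (toInvLim fun N : TensorFilter G => N.1) (tmk_mul_right y t z)).trans (map_mul _ _ _)

theorem wedge_mul_left (x y z : G) :
    wedge (x * y) z = wedge (y⁻¹ * x * y) (y⁻¹ * z * y) * wedge y z :=
  congrArg (QuotientGroup.mk' (nabla G)) (ctmk_mul_left x y z)

theorem wedge_mul_right (y t z : G) :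
    wedge y (t * z) = wedge y z * wedge (z⁻¹ * y * z) (z⁻¹ * t * z) :=
  congrArg (QuotientGroup.mk' (nabla G)) (ctmk_mul_right y t z)

theorem continuous_ctmk : Continuous fun z : G × G => ctmk z.1 z.2 :=
  Continuous.subtype_mk (continuous_pi fun N : TensorFilter G => N.2.2.2) _

/-- Provides the measurability needed for the Haar measure argument. -/
theorem isClosed_exteriorPairs : IsClosed (exteriorPairs G) := by
  have h : exteriorPairs G = (fun z : G × G => ctmk z.1 z.2) ⁻¹' (nabla G : Set _) := by
    ext z
    exact QuotientGroup.eq_one_iff (N := nabla G) (ctmk z.1 z.2)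
  rw [h]
  exact (Subgroup.isClosed_topologicalClosure _).preimage continuous_ctmk

end Symbols

/-! ### Functoriality -/

section Functoriality

variable {G K : Type*} [Group G] [Group K]

/-- The homomorphism of abstract tensor squares induced by a homomorphism of groups. -/
def TensorSquare.map (f : G →* K) : TensorSquare G →* TensorSquare K :=
  PresentedGroup.toGroup (f := fun z : G × G => (tmk (f z.1) (f z.2) : TensorSquare K)) <| by
    rintro r (⟨x, y, z, rfl⟩ | ⟨x, y, z, rfl⟩)
    · simp only [map_mul, map_inv, FreeGroup.lift_apply_of]
      rw [mul_inv_eq_one]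
      exact tmk_mul_left _ _ _
    · simp only [map_mul, map_inv, FreeGroup.lift_apply_of]
      rw [mul_inv_eq_one]
      exact tmk_mul_right _ _ _

theorem TensorSquare.map_tmk (f : G →* K) (x y : G) :
    TensorSquare.map f (tmk x y) = tmk (f x) (f y) :=
  PresentedGroup.toGroup.of _

variable [TopologicalSpace G] [TopologicalSpace K]

/-- The pullback of the finite quotients of the tensor square along a continuous
homomorphism. -/
def TensorFilter.comap (f : G →* K) (hf : Continuous f) (N : TensorFilter K) : TensorFilter G :=
  ⟨N.1.comap (TensorSquare.map f), inferInstance,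
    ⟨by
      rw [Subgroup.index_comap]
      exact fun h => N.2.2.1.index_ne_zero
        (Nat.eq_zero_of_zero_dvd (h ▸ N.1.relIndex_dvd_index_of_normal _))⟩, by
    let φ : TensorSquare G ⧸ N.1.comap (TensorSquare.map f) → TensorSquare K ⧸ N.1 :=
      QuotientGroup.map _ _ (TensorSquare.map f) le_rfl
    -- An injection between discrete quotients reflects continuity, so it suffices to check the
    -- symbol map after `φ`.
    have hφ : Function.Injective φ := by
      rw [injective_iff_map_eq_one
        (QuotientGroup.map (N.1.comap (TensorSquare.map f)) N.1 (TensorSquare.map f) le_rfl)]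
      intro a ha
      obtain ⟨t, rfl⟩ := QuotientGroup.mk_surjective a
      exact (QuotientGroup.eq_one_iff t).mpr ((QuotientGroup.eq_one_iff (N := N.1) _).mp ha)
    have hc : Continuous fun z : G × G => φ (tmk z.1 z.2 : TensorSquare G) := by
      have h : (fun z : G × G => φ (tmk z.1 z.2 : TensorSquare G)) =
          (fun z : K × K => (tmk z.1 z.2 : TensorSquare K ⧸ N.1)) ∘ Prod.map f f := by
        funext z
        exact congrArg _ (TensorSquare.map_tmk f z.1 z.2)
      rw [h]
      exact N.2.2.2.comp (hf.prodMap hf)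
    have hd : DiscreteTopology (TensorSquare K ⧸ N.1) :=
      QuotientGroup.discreteTopology (isOpen_discrete _)
    have : DiscreteTopology (TensorSquare G ⧸ N.1.comap (TensorSquare.map f)) :=
      QuotientGroup.discreteTopology (isOpen_discrete _)
    refine continuous_discrete_rng.mpr fun b => ?_
    convert hc.isOpen_preimage {φ b} (isOpen_discrete _) using 1
    ext z
    exact hφ.eq_iff.symm⟩

/-- The homomorphism of complete tensor squares induced by a continuous homomorphism. -/
def CompleteTensorSquare.map (f : G →* K) (hf : Continuous f) :
    CompleteTensorSquare G →* CompleteTensorSquare K where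
  toFun x := ⟨fun N => QuotientGroup.map (TensorFilter.comap f hf N).1 N.1 (TensorSquare.map f)
    le_rfl (x.1 (TensorFilter.comap f hf N)), fun i j h => by
      have hx := x.2 (TensorFilter.comap f hf i) (TensorFilter.comap f hf j)
        (Subgroup.comap_mono h)
      obtain ⟨t, ht⟩ := QuotientGroup.mk_surjective (x.1 (TensorFilter.comap f hf i))
      beta_reduce
      erw [← hx, ← ht]
      rfl⟩
  map_one' := Subtype.ext (funext fun _ => map_one _)
  map_mul' _ _ := Subtype.ext (funext fun _ => map_mul _ _ _)

theorem CompleteTensorSquare.map_ctmk (f : G →* K) (hf : Continuous f) (x y : G) :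
    CompleteTensorSquare.map f hf (ctmk x y) = ctmk (f x) (f y) :=
  Subtype.ext (funext fun N => congrArg (QuotientGroup.mk' N.1) (TensorSquare.map_tmk f x y))

theorem CompleteTensorSquare.continuous_apply (N : TensorFilter G) :
    Continuous fun x : CompleteTensorSquare G => x.1 N := by
  change Continuous fun x : invLim (fun N : TensorFilter G => N.1) => x.1 N
  exact (_root_.continuous_apply N).comp continuous_subtype_val

theorem CompleteTensorSquare.continuous_map (f : G →* K) (hf : Continuous f) :
    Continuous (CompleteTensorSquare.map f hf) := by
  refine Continuous.subtype_mk (continuous_pi fun N => ?_) _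
  have hd : DiscreteTopology (TensorSquare G ⧸ (TensorFilter.comap f hf N).1) :=
    QuotientGroup.discreteTopology (isOpen_discrete _)
  exact continuous_of_discreteTopology.comp
    (CompleteTensorSquare.continuous_apply (TensorFilter.comap f hf N))

/-- Generators `x ⊗ x` go to generators, and the preimage of a closed subgroup is closed. -/
theorem nabla_le_comap_map (f : G →* K) (hf : Continuous f) :
    nabla G ≤ (nabla K).comap (CompleteTensorSquare.map f hf) := by
  refine Subgroup.topologicalClosure_minimal _ ?_
    ((Subgroup.isClosed_topologicalClosure _).preimage
      (CompleteTensorSquare.continuous_map f hf))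
  rw [Subgroup.closure_le]
  rintro _ ⟨x, rfl⟩
  change CompleteTensorSquare.map f hf (ctmk x x) ∈ nabla K
  rw [CompleteTensorSquare.map_ctmk]
  exact Subgroup.le_topologicalClosure _ (Subgroup.subset_closure ⟨f x, rfl⟩)

theorem wedge_map_eq_one (f : G →* K) (hf : Continuous f) {x y : G} (h : wedge x y = 1) :
    wedge (f x) (f y) = 1 := by
  have h' := nabla_le_comap_map f hf ((QuotientGroup.eq_one_iff (N := nabla G) _).mp h)
  rw [Subgroup.mem_comap, CompleteTensorSquare.map_ctmk] at h'
  exact (QuotientGroup.eq_one_iff (N := nabla K) _).mpr h'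

end Functoriality

/-! ### Products of groups of coprime orders -/

section Coprime

variable {K : Type*} [Group K] [TopologicalSpace K]

/-- If `x` and `y` commute, and the `m`-power iterates of `x` and the `n`-power iterates of `y`
tend to `1` for coprime `m` and `n`, then `x ⊗ y` is trivial. -/
theorem ctmk_eq_one_of_tendsto {m n : ℕ} (hmn : m.Coprime n) {x y : K} (hxy : Commute x y)
    (hx : Filter.Tendsto (fun k : ℕ => x ^ m ^ k) Filter.atTop (𝓝 1))
    (hy : Filter.Tendsto (fun k : ℕ => y ^ n ^ k) Filter.atTop (𝓝 1)) :
    ctmk x y = 1 := by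
  refine Subtype.ext (funext fun N => ?_)
  change (tmk x y : TensorSquare K ⧸ N.1) = 1
  have hd : DiscreteTopology (TensorSquare K ⧸ N.1) :=
    QuotientGroup.discreteTopology (isOpen_discrete _)
  have hcont := N.2.2.2
  -- The images of `x ^ m ^ k ⊗ y` tend to that of `1 ⊗ y = 1` in a discrete group, hence are
  -- eventually trivial.
  have h1 : ∃ k, (tmk x y : TensorSquare K ⧸ N.1) ^ m ^ k = 1 := by
    have ht := (hcont.tendsto (1, y)).comp (hx.prodMk_nhds tendsto_const_nhds)
    rw [nhds_discrete, Filter.tendsto_pure] at ht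
    obtain ⟨k, hk⟩ := ht.exists
    refine ⟨k, ?_⟩
    simpa [tmk_pow_left hxy, tmk_one_left] using hk
  have h2 : ∃ k, (tmk x y : TensorSquare K ⧸ N.1) ^ n ^ k = 1 := by
    have ht := (hcont.tendsto (x, 1)).comp (tendsto_const_nhds.prodMk_nhds hy)
    rw [nhds_discrete, Filter.tendsto_pure] at ht
    obtain ⟨k, hk⟩ := ht.exists
    refine ⟨k, ?_⟩
    simpa [tmk_pow_right hxy, tmk_one_right] using hk
  obtain ⟨k, hk⟩ := h1
  obtain ⟨l, hl⟩ := h2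
  rw [← orderOf_eq_one_iff]
  exact Nat.eq_one_of_dvd_coprimes (hmn.pow k l) (orderOf_dvd_of_pow_eq_one hk)
    (orderOf_dvd_of_pow_eq_one hl)

variable {p q : ℕ}
  {G : Type*} [Group G] [TopologicalSpace G] [IsTopologicalGroup G] [CompactSpace G] [T2Space G]
  {H : Type*} [Group H] [TopologicalSpace H] [IsTopologicalGroup H] [CompactSpace H] [T2Space H]

theorem IsProP.wedge_inl_inr (hpq : p.Coprime q) (hG : IsProP p G) (hH : IsProP q H)
    (g : G) (h : H) : wedge ((g, 1) : G × H) (1, h) = 1 := by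
  refine congrArg (QuotientGroup.mk' (nabla (G × H)))
    (ctmk_eq_one_of_tendsto hpq (by simp [Commute, SemiconjBy]) ?_ ?_)
  · simpa [Prod.pow_mk, ← Prod.one_eq_mk] using
      (hG.tendsto_pow g).prodMk_nhds (tendsto_const_nhds (x := (1 : H)))
  · simpa [Prod.pow_mk, ← Prod.one_eq_mk] using
      (tendsto_const_nhds (x := (1 : G))).prodMk_nhds (hH.tendsto_pow h)

theorem IsProP.wedge_inr_inl (hpq : p.Coprime q) (hG : IsProP p G) (hH : IsProP q H)
    (h : H) (g : G) : wedge ((1, h) : G × H) (g, 1) = 1 := by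
  refine congrArg (QuotientGroup.mk' (nabla (G × H)))
    (ctmk_eq_one_of_tendsto hpq.symm (by simp [Commute, SemiconjBy]) ?_ ?_)
  · simpa [Prod.pow_mk, ← Prod.one_eq_mk] using
      (tendsto_const_nhds (x := (1 : G))).prodMk_nhds (hH.tendsto_pow h)
  · simpa [Prod.pow_mk, ← Prod.one_eq_mk] using
      (hG.tendsto_pow g).prodMk_nhds (tendsto_const_nhds (x := (1 : H)))

theorem IsProP.wedge_prod_eq_one_iff (hpq : p.Coprime q) (hG : IsProP p G) (hH : IsProP q H)
    (a b : G × H) : wedge a b = 1 ↔ wedge a.1 b.1 = 1 ∧ wedge a.2 b.2 = 1 := by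
  refine ⟨fun h => ⟨wedge_map_eq_one (MonoidHom.fst G H) continuous_fst h,
    wedge_map_eq_one (MonoidHom.snd G H) continuous_snd h⟩, fun ⟨h1, h2⟩ => ?_⟩
  obtain ⟨g, h⟩ := a
  obtain ⟨g', h'⟩ := b
  have e1 : wedge ((g, 1) : G × H) (g', 1) = 1 :=
    wedge_map_eq_one (MonoidHom.inl G H) (continuous_id.prodMk continuous_const) h1
  have e2 : wedge ((1, h) : G × H) (1, h') = 1 :=
    wedge_map_eq_one (MonoidHom.inr G H) (continuous_const.prodMk continuous_id) h2
  -- General `k` is needed: the final expansion conjugates by `(1, h)` and so calls for `k = h⁻¹ *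
  -- h' * h`.
  have e3 : ∀ k : H, wedge ((g, 1) : G × H) (g', k) = 1 := fun k => by
    have := wedge_mul_right ((g, 1) : G × H) (g', 1) (1, k)
    simpa [e1, hG.wedge_inl_inr hpq hH] using this
  have e4 : wedge ((1, h) : G × H) (g', h') = 1 := by
    have := wedge_mul_right ((1, h) : G × H) (g', 1) (1, h')
    simpa [e2, hG.wedge_inr_inl hpq hH] using this
  have := wedge_mul_left ((g, 1) : G × H) (1, h) (g', h')
  simpa [e3, e4] using this

end Coprime

end CompleteExterior

open CompleteExterior in
theorem theorem3p9 {p q : ℕ} (hp : p.Prime) (hq : q.Prime) (hpq : p ≠ q)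
    {G : Type*} [Group G] [TopologicalSpace G] [IsTopologicalGroup G] [CompactSpace G] [T2Space G]
    {H : Type*} [Group H] [TopologicalSpace H] [IsTopologicalGroup H] [CompactSpace H] [T2Space H]
    (hG : CompleteExterior.IsProP p G) (hH : CompleteExterior.IsProP q H) :
    CompleteExterior.exteriorDegree (G × H) =
      CompleteExterior.exteriorDegree G * CompleteExterior.exteriorDegree H := by
  have hcop : p.Coprime q := (Nat.coprime_primes hp hq).mpr hpq
  let : MeasurableSpace (G × G) := borel (G × G)
  have : BorelSpace (G × G) := ⟨rfl⟩
  let : MeasurableSpace (H × H) := borel (H × H)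
  have : BorelSpace (H × H) := ⟨rfl⟩
  let : MeasurableSpace ((G × H) × (G × H)) := borel ((G × H) × (G × H))
  have : BorelSpace ((G × H) × (G × H)) := ⟨rfl⟩
  let f : (G × H) × (G × H) →* G × G := (MonoidHom.fst G H).prodMap (MonoidHom.fst G H)
  let g : (G × H) × (G × H) →* H × H := (MonoidHom.snd G H).prodMap (MonoidHom.snd G H)
  have hpairs : exteriorPairs (G × H) = f ⁻¹' exteriorPairs G ∩ g ⁻¹' exteriorPairs H := by
    ext z
    exact hG.wedge_prod_eq_one_iff hcop hH z.1 z.2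
  have hmul := haarMeasure_top_preimage_inter f (continuous_fst.prodMap continuous_fst)
    g (continuous_snd.prodMap continuous_snd)
    -- Together `f` and `g` merely reorder the four coordinates.
    (fun w => ⟨((w.1.1, w.2.1), (w.1.2, w.2.2)), rfl⟩)
    (isClosed_exteriorPairs (G := G)).measurableSet (isClosed_exteriorPairs (G := H)).measurableSet
  rw [← hpairs] at hmul
  exact (congrArg ENNReal.toReal hmul).trans ENNReal.toReal_mul
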